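/- Let $A,B$ be rational numbers with $A>B\ge 0$ such that $Ax^2+Bx$ takes integer values at all integers $x$, and let $S$ be a finite set of pairwise coprime positive integers. For integers $k\ge 1$ and $n\ge 0$ define $\gamma^k_{S,A,B}(n)$ by the identity of formal power series $$\prod_{s\in S}\frac{1}{1-q^s}\sum_{j\notin[-k,k-1]}(-1)^{j+k}q^{Aj^2+Bj}=\sum_{n\ge 0}\gamma^k_{S,A,B}(n)\,q^n,$$ where $j$ runs over all integers outside the interval $[-k,k-1]$. Let $Z=\{2,3,7,13,17\}$ and $(A,B)\in\{(5/2,3/2),(5/2,1/2),(7/2,5/2),(7/2,3/2)\}$. Then $\gamma^k_{Z,A,B}(n)\ge 0$ for all integers $k\ge 1$ and $n\ge 0$. Consequently (Merca's conjecture), for the same $(A,B)$ and all integers $k\ge 1$, $$\frac{1}{(q^2,q^3;q^5)_\infty}\sum_{j\notin[-k,k-1]}(-1)^{j+k}q^{Aj^2+Bj}\in\mathbb{N}[[q]],$$ where $(q^2,q^3;q^5)_\infty=\prod_{i\ge 0}(1-q^{5i+2})(1-q^{5i+3})$ and $\mathbb{N}[[q]]$ is the set of formal power series whose coefficients are non-negative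 integers. -/

import Mathlib

namespace TruncatedTheta

open PowerSeries
open scoped PowerSeries.WithPiTopology

/-- The reciprocal `1 / f` in `ℤ⟦q⟧` of a power series `f` with constant coefficient `1`
(all reciprocals below are of this kind). -/
noncomputable def recip (f : PowerSeries ℤ) : PowerSeries ℤ :=
  PowerSeries.invOfUnit f 1

theorem mul_recip (f : PowerSeries ℤ) (hf : PowerSeries.constantCoeff f = 1) :
    f * recip f = 1 :=
  PowerSeries.mul_invOfUnit f 1 (by simpa using hf)

/-- The integers `j ∉ [-k, k-1]` whose exponent `A j² + B j` equals `n`. -/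
def tailIndices (A B : ℚ) (k n : ℕ) : Set ℤ :=
  {j : ℤ | j ∉ Set.Icc (-(k : ℤ)) ((k : ℤ) - 1) ∧ A * (j : ℚ) ^ 2 + B * (j : ℚ) = (n : ℚ)}

theorem tailIndices_finite (A B : ℚ) (hB : 0 ≤ B) (hAB : B < A) (k n : ℕ) :
    (tailIndices A B k n).Finite := by
  have hA : A ≠ 0 := by linarith
  have hp : (Polynomial.C A * Polynomial.X ^ 2 + Polynomial.C B * Polynomial.X
      + Polynomial.C (-(n : ℚ)) : Polynomial ℚ) ≠ 0 := by
    intro h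
    have h2 := Polynomial.natDegree_quadratic (b := B) (c := -(n : ℚ)) hA
    rw [h] at h2
    simp at h2
  have hfin := Polynomial.finite_setOfPred_isRoot hp
  refine Set.Finite.subset (hfin.preimage (f := fun j : ℤ => (j : ℚ))
    (Int.cast_injective.injOn)) ?_
  rintro j ⟨-, hj⟩
  simp only [Set.mem_preimage, Set.mem_ofPred_eq, Polynomial.IsRoot, Polynomial.eval_add,
    Polynomial.eval_mul, Polynomial.eval_C, Polynomial.eval_pow, Polynomial.eval_X]
  linarith

/-- The series `∑_{j ∉ [-k, k-1]} (-1)^(j+k) q^(A j² + B j)`, with its terms collected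
according to the exponent `n = A j² + B j`. For `A > B ≥ 0` each of the sums is finite
(`tailIndices_finite`); if moreover `A x² + B x` is integer valued, then all exponents are natural
numbers, so that no term is lost. -/
noncomputable def thetaTail (A B : ℚ) (k : ℕ) : PowerSeries ℤ :=
  PowerSeries.mk fun n => ∑ᶠ j ∈ tailIndices A B k n, (((j + (k : ℤ)).negOnePow : ℤˣ) : ℤ)

/-- The coefficient `γ_{S,A,B}^k(n)` of `q^n` in
`∏_{s ∈ S} 1/(1 - q^s) · ∑_{j ∉ [-k, k-1]} (-1)^(j+k) q^(A j² + B j)`. -/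
noncomputable def gammaCoeff (S : Finset ℕ) (A B : ℚ) (k n : ℕ) : ℤ :=
  PowerSeries.coeff n
    ((∏ s ∈ S, recip (1 - (PowerSeries.X : PowerSeries ℤ) ^ s)) * thetaTail A B k)

/-- The infinite `q`-shifted factorial `(a; p)_∞ = ∏_{i ≥ 0} (1 - a p^i)`, for power series
`a`, `p`; the product converges coefficientwise if `p` has constant coefficient `0`. -/
noncomputable def qPochInf (a p : PowerSeries ℤ) : PowerSeries ℤ :=
  ∏' i : ℕ, (1 - a * p ^ i)

theorem multipliable_qPochInf (a p : PowerSeries ℤ) (hp : PowerSeries.constantCoeff p = 0) :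
    Multipliable fun i : ℕ => 1 - a * p ^ i := by
  simp_rw [sub_eq_add_neg]
  apply PowerSeries.WithPiTopology.multipliable_one_add_of_tendsto_order_atTop_nhds_top
  refine ENat.tendsto_nhds_top_iff_natCast_lt.mpr
    (fun n => Filter.eventually_atTop.mpr ⟨n + 1, fun i hi => ?_⟩)
  rw [PowerSeries.order_neg]
  have h1 : (i : ℕ∞) ≤ (p ^ i).order := by
    apply PowerSeries.nat_le_order
    exact PowerSeries.X_pow_dvd_iff.mp (pow_dvd_pow_of_dvd (PowerSeries.X_dvd_iff.mpr hp) i)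
  calc (n : ℕ∞) < (i : ℕ∞) := by exact_mod_cast hi
    _ ≤ (p ^ i).order := h1
    _ ≤ a.order + (p ^ i).order := le_add_self
    _ ≤ (a * p ^ i).order := PowerSeries.le_order_mul _ _

theorem constantCoeff_qPochInf (a p : PowerSeries ℤ) (ha : PowerSeries.constantCoeff a = 0)
    (hp : PowerSeries.constantCoeff p = 0) : PowerSeries.constantCoeff (qPochInf a p) = 1 := by
  unfold qPochInf
  rw [(multipliable_qPochInf a p hp).map_tprod _
    (PowerSeries.WithPiTopology.continuous_constantCoeff ℤ)]
  simp [ha]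

/-- `f ∈ ℕ⟦q⟧`. -/
def HasNatCoeffs (f : PowerSeries ℤ) : Prop :=
  ∃ g : PowerSeries ℕ, PowerSeries.map (Nat.castRingHom ℤ) g = f

end TruncatedTheta

/-!
Put `A = a + b / 2`, `B = b / 2` and `e m = A m² + B m`. Pairing `j = m` with `j = -m - 1`, the
coefficients `γ k n` satisfy `γ k n + γ (k + 1) n = p (n - e k) - p (n - e k - a (2 k + 1))`, where
`p` counts partitions into parts `2, 3, 7, 13, 17`, and `γ k n = 0` for `n < e k`
(`gammaCoeff_add_succ`, `gammaCoeff_eq_zero`). Everything follows from these two facts.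

Since the parts are pairwise coprime, the only multiple pole of `∏ 1 / (1 - q ^ s)` is at `q = 1`,
so `p` is a polynomial of degree `4` plus a bounded periodic function (`partCount_eq_quasiPoly`,
`abs_periodicPart_le`). Unrolling the recursion, `γ k n` is a difference of two alternating sums of
values of `p` at quadratic progressions. For the polynomial part, Boole summation evaluates such a
sum in closed form (`sum_polyPart`): a main term at the beginning of the progression, of order
`k (n - e k)³` for the difference of the two sums, and a boundary term where the argument becomes
negative, bounded in `abs_boolePoly_le`. The periodic part contributes at most a constant for each
term of the sums. With `x = n - e k`, the main term dominates as soon as `x ≥ 100` and at least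
two terms occur (`boolePoly_sub_gt`). If only one term occurs, it is `p x - p (x - c)` with `c ≥ 2`,
which is nonnegative because `c` is a sum of parts `2` and `3` (`partCount_sub_nonneg`). The
finitely many cases that are left, with `x < 100` and `k < 20`, are computed (`smallCheck`).

The statement on `(q², q³; q⁵)_∞` follows, as this product contains the factors `1 - q ^ s` with
`s ∈ {2, 3, 7, 13, 17}` and the reciprocals of the others have nonnegative coefficients.
-/

namespace TruncatedTheta

open PowerSeries
open scoped PowerSeries.WithPiTopology

/-! ### The quasi-polynomial counting partitions into parts `2, 3, 7, 13, 17` -/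

/-- The coefficients of a power series, extended by zero to negative indices. -/
noncomputable def extCoeff (f : PowerSeries ℤ) (n : ℤ) : ℤ :=
  if 0 ≤ n then coeff n.toNat f else 0

theorem extCoeff_natCast (f : PowerSeries ℤ) (n : ℕ) : extCoeff f n = coeff n f := by
  simp [extCoeff]

theorem extCoeff_of_neg (f : PowerSeries ℤ) {n : ℤ} (hn : n < 0) : extCoeff f n = 0 := by
  simp [extCoeff, hn]

/-- The backward difference of step `s`. -/
def bdiff (s : ℕ) (f : ℤ → ℤ) (n : ℤ) : ℤ := f n - f (n - s)

theorem extCoeff_mul_X_pow (f : PowerSeries ℤ) (s : ℕ) (n : ℤ) :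
    extCoeff (f * X ^ s) n = extCoeff f (n - s) := by
  unfold extCoeff
  by_cases h : 0 ≤ n
  · lift n to ℕ using h
    by_cases hs : s ≤ n
    · have e : ((n : ℤ) - s).toNat = n - s := by omega
      have h0 : (0 : ℤ) ≤ (n : ℤ) - s := by omega
      rw [if_pos (by positivity), if_pos h0, coeff_mul_X_pow', e]
      simp [hs]
    · have h0 : ¬ (0 : ℤ) ≤ (n : ℤ) - s := by omega
      rw [if_pos (by positivity), if_neg h0, coeff_mul_X_pow']
      simp [hs]
  · rw [if_neg h, if_neg (by omega)]

theorem extCoeff_mul_one_sub (f : PowerSeries ℤ) (s : ℕ) :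
    extCoeff (f * (1 - X ^ s)) = bdiff s (extCoeff f) := by
  funext n
  rw [bdiff, ← extCoeff_mul_X_pow, mul_sub, mul_one]
  unfold extCoeff
  split_ifs <;> simp

theorem extCoeff_one (n : ℤ) : extCoeff 1 n = if n = 0 then 1 else 0 := by
  unfold extCoeff
  rw [coeff_one]
  split_ifs <;> first | rfl | omega

/-- The generating function of the partitions into parts `2, 3, 7, 13, 17`. -/
noncomputable def partSeries : PowerSeries ℤ :=
  ∏ s ∈ ({2, 3, 7, 13, 17} : Finset ℕ), recip (1 - (X : PowerSeries ℤ) ^ s)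

theorem one_sub_X_pow_mul_recip {s : ℕ} (hs : s ≠ 0) :
    (1 - (X : PowerSeries ℤ) ^ s) * recip (1 - X ^ s) = 1 :=
  mul_recip _ (by simp [hs])

theorem partSeries_mul :
    partSeries * (1 - X ^ 2) * (1 - X ^ 3) * (1 - X ^ 7) * (1 - X ^ 13) * (1 - X ^ 17) = 1 := by
  have e : partSeries = recip (1 - X ^ 2) * (recip (1 - X ^ 3) * (recip (1 - X ^ 7) *
      (recip (1 - X ^ 13) * recip (1 - X ^ 17)))) := by
    simp [partSeries]
  rw [e]
  calc _ = ((1 - (X : PowerSeries ℤ) ^ 2) * recip (1 - X ^ 2)) *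
      ((1 - (X : PowerSeries ℤ) ^ 3) * recip (1 - X ^ 3)) *
      ((1 - (X : PowerSeries ℤ) ^ 7) * recip (1 - X ^ 7)) *
      ((1 - (X : PowerSeries ℤ) ^ 13) * recip (1 - X ^ 13)) *
      ((1 - (X : PowerSeries ℤ) ^ 17) * recip (1 - X ^ 17)) := by ring
    _ = 1 := by
      simp only [one_sub_X_pow_mul_recip (show (2 : ℕ) ≠ 0 by norm_num),
        one_sub_X_pow_mul_recip (show (3 : ℕ) ≠ 0 by norm_num),
        one_sub_X_pow_mul_recip (show (7 : ℕ) ≠ 0 by norm_num),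
        one_sub_X_pow_mul_recip (show (13 : ℕ) ≠ 0 by norm_num),
        one_sub_X_pow_mul_recip (show (17 : ℕ) ≠ 0 by norm_num), mul_one]

/-- The number of partitions of `n` into parts `2, 3, 7, 13, 17`; zero for negative `n`. -/
noncomputable def partCount : ℤ → ℤ := extCoeff partSeries

theorem bdiff_partCount (n : ℤ) :
    ([2, 3, 7, 13, 17] : List ℕ).foldl (fun g s => bdiff s g) partCount n =
      if n = 0 then 1 else 0 := by
  simp only [List.foldl, partCount, ← extCoeff_mul_one_sub, partSeries_mul, extCoeff_one]

theorem foldl_bdiff_linear (L : List ℕ) (f g : ℤ → ℤ) (c : ℤ) :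
    L.foldl (fun g s => bdiff s g) (fun n => c * f n - g n) =
      fun n => c * L.foldl (fun g s => bdiff s g) f n - L.foldl (fun g s => bdiff s g) g n := by
  induction L generalizing f g with
  | nil => rfl
  | cons s L ih =>
    simp only [List.foldl]
    rw [← ih]
    congr 1
    funext n
    simp only [bdiff]
    ring

/-- A solution of the homogeneous recurrence `∏ (1 - E⁻ˢ) g = 0` that vanishes at as many
consecutive places as the order of the recurrence vanishes from there on. -/
theorem eq_zero_of_foldl_bdiff (L : List ℕ) (hL : ∀ s ∈ L, 0 < s) (g : ℤ → ℤ)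
    (h0 : ∀ n : ℤ, -(L.sum : ℤ) < n → n ≤ 0 → g n = 0)
    (h : ∀ n : ℤ, 0 < n → L.foldl (fun g s => bdiff s g) g n = 0) :
    ∀ n : ℤ, 0 < n → g n = 0 := by
  induction L generalizing g with
  | nil => exact h
  | cons s L ih =>
    simp only [List.sum_cons, Nat.cast_add] at h0
    have hs : 0 < s := hL s (by simp)
    have h1 : ∀ n : ℤ, 0 < n → bdiff s g n = 0 := by
      refine ih (fun t ht => hL t (by simp [ht])) (bdiff s g) (fun n hn hn0 => ?_) h
      rw [bdiff, h0 n (by omega) hn0, h0 (n - s) (by omega) (by omega), sub_zero]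
    have h2 : ∀ m : ℕ, ∀ n : ℤ, n ≤ m → -((s : ℤ) + L.sum) < n → g n = 0 := by
      intro m
      induction m with
      | zero => exact fun n hn hn0 => h0 n hn0 (by simpa using hn)
      | succ m ihm =>
        intro n hn hn0
        by_cases hpos : 0 < n
        · have := h1 n hpos
          rw [bdiff, ihm (n - s) (by push_cast at hn; omega) (by omega)] at this
          omega
        · exact h0 n hn0 (by omega)
    exact fun n hn => h2 n.toNat n (by omega) (by omega)

/-- The periodic parts of the quasi-polynomial, scaled by `144 * 9282`; the entry at `s` lists
the values on the residues modulo `s`. -/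
def periodicTables : List (ℕ × List ℤ) :=
  [(2, [41769, -41769]),
   (3, [99008, -49504, -49504]),
   (7, [0, 0, 190944, -190944, -190944, 190944, 0]),
   (13, [205632, -205632, 102816, 102816, 205632, -411264, 205632, 102816, 102816, -205632,
     205632, -205632, -205632]),
   (17, [471744, -393120, 157248, 235872, -78624, -78624, 235872, 157248, -393120, 471744,
     -78624, -235872, -235872, 314496, -235872, -235872, -78624])]

/-- The value at `n` of the `s`-periodic function with the given table of values. -/
def periodicVal (t : ℕ × List ℤ) (n : ℤ) : ℤ := t.2.getD (n % t.1).toNat 0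

/-- The sum of the periodic parts. -/
def periodicPart (n : ℤ) : ℤ :=
  (periodicTables.map fun t => periodicVal t n).sum

/-- The polynomial part, scaled by `144 * 9282`. It is even in `z = n + 21`, where
`21 = (2 + 3 + 7 + 13 + 17) / 2`. -/
def polyPart {R : Type*} [CommRing R] (z : R) : R := 6 * z ^ 4 - 1560 * z ^ 2 + 39529

theorem bdiff_periodicVal (t : ℕ × List ℤ) : bdiff t.1 (periodicVal t) = fun _ => 0 := by
  funext n
  simp [bdiff, periodicVal]

theorem bdiff_comm (s t : ℕ) (f : ℤ → ℤ) : bdiff s (bdiff t f) = bdiff t (bdiff s f) := by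
  funext n
  simp only [bdiff]
  rw [show n - (s : ℤ) - t = n - t - s by ring]
  ring

theorem foldl_bdiff_zero (L : List ℕ) :
    L.foldl (fun g s => bdiff s g) (fun _ => 0) = fun _ => 0 := by
  induction L with
  | nil => rfl
  | cons s L ih =>
    have : bdiff s (fun _ => 0) = fun _ => 0 := by funext n; simp [bdiff]
    rw [List.foldl_cons, this, ih]

theorem foldl_bdiff_eq_zero (L : List ℕ) {s : ℕ} (hs : s ∈ L) {f : ℤ → ℤ}
    (hf : bdiff s f = fun _ => 0) : L.foldl (fun g s => bdiff s g) f = fun _ => 0 := by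
  induction L generalizing f with
  | nil => simp at hs
  | cons t L ih =>
    rw [List.foldl_cons]
    rcases List.mem_cons.mp hs with rfl | h
    · rw [hf, foldl_bdiff_zero]
    · refine ih h ?_
      rw [bdiff_comm, hf]
      funext n
      simp [bdiff]

theorem foldl_bdiff_polyPart :
    ([2, 3, 7, 13, 17] : List ℕ).foldl (fun g s => bdiff s g)
      (fun n : ℤ => polyPart (n + 21)) = fun _ => 0 := by
  funext n
  simp only [List.foldl, bdiff, polyPart]
  push_cast
  ring

theorem foldl_bdiff_add (L : List ℕ) (f g : ℤ → ℤ) :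
    L.foldl (fun g s => bdiff s g) (fun n => f n + g n) =
      fun n => L.foldl (fun g s => bdiff s g) f n + L.foldl (fun g s => bdiff s g) g n := by
  induction L generalizing f g with
  | nil => rfl
  | cons s L ih =>
    simp only [List.foldl]
    rw [← ih]
    congr 1
    funext n
    simp only [bdiff]
    ring

theorem foldl_bdiff_periodicPart (L : List ℕ) (T : List (ℕ × List ℤ))
    (hT : ∀ t ∈ T, t.1 ∈ L) :
    L.foldl (fun g s => bdiff s g) (fun n => (T.map fun t => periodicVal t n).sum) =
      fun _ => 0 := by
  induction T with
  | nil => simpa using foldl_bdiff_zero L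
  | cons t T ih =>
    simp only [List.map_cons, List.sum_cons]
    rw [foldl_bdiff_add, ih fun u hu => hT u (by simp [hu]),
      foldl_bdiff_eq_zero L (hT t (by simp)) (bdiff_periodicVal t)]
    simp

/-- The quasi-polynomial, scaled by `1336608 = 144 * 9282`, where `9282 = 2 * 3 * 7 * 13 * 17`. -/
def quasiPoly (n : ℤ) : ℤ := polyPart (n + 21) + periodicPart n

theorem foldl_bdiff_quasiPoly :
    ([2, 3, 7, 13, 17] : List ℕ).foldl (fun g s => bdiff s g) quasiPoly = fun _ => 0 := by
  have := foldl_bdiff_add [2, 3, 7, 13, 17] (fun n : ℤ => polyPart (n + 21)) periodicPart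
  rw [foldl_bdiff_polyPart] at this
  unfold quasiPoly
  rw [this]
  unfold periodicPart
  rw [foldl_bdiff_periodicPart _ _ (by decide)]
  simp

theorem partCount_of_neg {n : ℤ} (hn : n < 0) : partCount n = 0 := extCoeff_of_neg _ hn

theorem constantCoeff_recip (f : PowerSeries ℤ) : constantCoeff (recip f) = 1 := by
  simp [recip]

theorem partCount_zero : partCount 0 = 1 := by
  have : extCoeff partSeries ((0 : ℕ) : ℤ) = 1 := by
    rw [extCoeff_natCast, coeff_zero_eq_constantCoeff]
    simp [partSeries, constantCoeff_recip]
  simpa [partCount] using this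

/-- The quasi-polynomial is correct down to `-41`, where the count vanishes at the negative
arguments: this is what makes the `42` initial values free. -/
theorem partCount_eq_quasiPoly {n : ℤ} (hn : -42 < n) :
    1336608 * partCount n = quasiPoly n := by
  have init : ∀ m : ℤ, -42 < m → m ≤ 0 → 1336608 * partCount m - quasiPoly m = 0 := by
    have key : ∀ i : Fin 42, quasiPoly (-(i : ℕ)) = if (i : ℕ) = 0 then 1336608 else 0 := by
      decide +kernel
    intro m hm hm0
    obtain ⟨i, rfl⟩ : ∃ i : ℕ, m = -i := ⟨m.natAbs, by omega⟩
    have := key ⟨i, by omega⟩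
    simp only at this
    rw [this]
    by_cases hi : i = 0
    · subst hi
      simp [partCount_zero]
    · rw [partCount_of_neg (by omega)]
      simp [hi]
  by_cases h : n ≤ 0
  · exact sub_eq_zero.mp (init n hn h)
  · refine sub_eq_zero.mp (eq_zero_of_foldl_bdiff [2, 3, 7, 13, 17] (by decide)
      (fun n => 1336608 * partCount n - quasiPoly n) (fun m hm => init m (by simpa using hm))
      (fun m hm => ?_) n (by omega))
    rw [foldl_bdiff_linear]
    beta_reduce
    rw [bdiff_partCount, foldl_bdiff_quasiPoly]
    simp [hm.ne']

theorem abs_periodicVal_le {t : ℕ × List ℤ} {c : ℤ} (h : ∀ x ∈ t.2, |x| ≤ c) (hc : 0 ≤ c)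
    (n : ℤ) : |periodicVal t n| ≤ c := by
  unfold periodicVal
  rw [List.getD_eq_getElem?_getD]
  rcases hx : t.2[(n % t.1).toNat]? with _ | x
  · simpa using hc
  · exact h x (List.mem_of_getElem? hx)

/-- The bound is the sum of the maxima of the five tables. -/
theorem abs_periodicPart_le (n : ℤ) : |periodicPart n| ≤ 1214729 := by
  have h2 := abs_le.mp (abs_periodicVal_le (t := periodicTables[0]) (c := 41769)
    (by decide) (by norm_num) n)
  have h3 := abs_le.mp (abs_periodicVal_le (t := periodicTables[1]) (c := 99008)
    (by decide) (by norm_num) n)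
  have h7 := abs_le.mp (abs_periodicVal_le (t := periodicTables[2]) (c := 190944)
    (by decide) (by norm_num) n)
  have h13 := abs_le.mp (abs_periodicVal_le (t := periodicTables[3]) (c := 411264)
    (by decide) (by norm_num) n)
  have h17 := abs_le.mp (abs_periodicVal_le (t := periodicTables[4]) (c := 471744)
    (by decide) (by norm_num) n)
  have e : periodicPart n = periodicVal periodicTables[0] n + (periodicVal periodicTables[1] n +
      (periodicVal periodicTables[2] n + (periodicVal periodicTables[3] n +
      (periodicVal periodicTables[4] n + 0)))) := rfl
  rw [e, abs_le]
  constructor <;> linarith [h2.1, h2.2, h3.1, h3.2, h7.1, h7.2, h13.1, h13.2, h17.1, h17.2]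

/-! ### Boole summation along a quadratic progression -/

/-- The polynomial solution of
`h μ z + h (μ + Q) (z - μ - Q / 2) = 6 z⁴ - 1560 z² + 39529`. It is the value that Boole
summation assigns to `∑ i ≥ 0, (-1) ^ i * polyPart (z - μ * i - Q * i² / 2)`. -/
def boolePoly (Q μ z : ℚ) : ℚ :=
  3 * z ^ 4 + 6 * μ * z ^ 3 - 3 * μ ^ 3 * z + 9 / 2 * Q * μ * z ^ 2 - 3 * Q * μ ^ 3
    + (9 / 2 * Q ^ 2 - 780) * μ * z + (51 / 16 * Q ^ 3 - 195 * Q) * μ - 780 * z ^ 2 + 39529 / 2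

theorem boolePoly_add (Q μ z : ℚ) :
    boolePoly Q μ z + boolePoly Q (μ + Q) (z - μ - Q / 2) = polyPart z := by
  unfold boolePoly polyPart
  ring

theorem sum_polyPart (Q μ z : ℚ) (N : ℕ) :
    ∑ i ∈ Finset.range N, (-1) ^ i * polyPart (z - μ * i - Q * i ^ 2 / 2) =
      boolePoly Q μ z - (-1) ^ N * boolePoly Q (μ + Q * N) (z - μ * N - Q * N ^ 2 / 2) := by
  induction N with
  | zero => simp
  | succ N ih =>
    rw [Finset.sum_range_succ, ih, ← boolePoly_add Q (μ + Q * N)]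
    have e1 : μ + Q * N + Q = μ + Q * (N + 1 : ℕ) := by push_cast; ring
    have e2 : z - μ * N - Q * N ^ 2 / 2 - (μ + Q * N) - Q / 2 =
        z - μ * (N + 1 : ℕ) - Q * (N + 1 : ℕ) ^ 2 / 2 := by push_cast; ring
    rw [e1, e2, pow_succ]
    ring

/-- In the last interval of the progression, `boolePoly` has the order of magnitude `μ⁴`. With
`p = -z (z + μ)`, which lies in `[0, μ² / 4]` there, its leading part is `3 p (p + μ²)`. -/
theorem abs_boolePoly_le {Q μ z : ℚ} (hQ5 : 5 ≤ Q) (hQ7 : Q ≤ 7) (hμ : 33 ≤ μ) (hz : z ≤ 0)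
    (hμz : -μ ≤ z) : |boolePoly Q μ z| ≤ 3 / 2 * μ ^ 4 := by
  obtain ⟨v, rfl⟩ : ∃ v, z = -v := ⟨-z, by ring⟩
  have hQ0 : 0 ≤ Q := by linarith
  have hv0 : 0 ≤ v := by linarith
  have hvμ : v ≤ μ := by linarith
  have hμ0 : 0 ≤ μ := by linarith
  have hd : 0 ≤ μ - 33 := by linarith
  set p := v * (μ - v) with hp
  have hp0 : 0 ≤ p := mul_nonneg hv0 (by linarith)
  have hp1 : p ≤ μ ^ 2 / 4 := by rw [hp]; linarith [sq_nonneg (μ - 2 * v)]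
  have lead : boolePoly Q μ (-v) = 3 * (p * (p + μ ^ 2)) + (9 / 2 * Q * μ * v ^ 2 - 3 * Q * μ ^ 3
      - (9 / 2 * Q ^ 2 - 780) * μ * v + (51 / 16 * Q ^ 3 - 195 * Q) * μ - 780 * v ^ 2
      + 39529 / 2) := by
    rw [hp, boolePoly]; ring
  have l0 : 0 ≤ p * (p + μ ^ 2) := by positivity
  have l1 : p * (p + μ ^ 2) ≤ 5 / 16 * μ ^ 4 := by
    calc p * (p + μ ^ 2) ≤ μ ^ 2 / 4 * (μ ^ 2 / 4 + μ ^ 2) := by gcongr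
      _ = 5 / 16 * μ ^ 4 := by ring
  have m1 : 33 * μ ≤ μ ^ 2 := by linarith [mul_nonneg hμ0 hd]
  have m2 : 33 * μ ^ 2 ≤ μ ^ 3 := by linarith [mul_nonneg (sq_nonneg μ) hd]
  have m3 : 33 * μ ^ 3 ≤ μ ^ 4 := by linarith [mul_nonneg (pow_nonneg hμ0 3) hd]
  have v1 : v ^ 2 ≤ μ ^ 2 := by gcongr
  have v2 : μ * v ≤ μ ^ 2 := by rw [pow_two]; gcongr
  have v3 : μ * v ^ 2 ≤ μ ^ 3 := by rw [pow_succ' μ 2]; gcongr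
  have v0 : 0 ≤ μ * v := by positivity
  have v4 : 0 ≤ μ * v ^ 2 := by positivity
  have q1 : 9 / 2 * Q * (μ * v ^ 2) ≤ 9 / 2 * Q * μ ^ 3 := by
    gcongr
  have q2 : Q * μ ^ 3 ≤ 7 * μ ^ 3 := by gcongr
  have q3 : 0 ≤ Q * (μ * v ^ 2) := by positivity
  have hQ2 : Q ^ 2 ≤ 49 := by linarith [mul_nonneg hQ0 (sub_nonneg.mpr hQ7)]
  have hQ2' : 25 ≤ Q ^ 2 := by linarith [mul_nonneg hQ0 (sub_nonneg.mpr hQ5)]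
  have q4 : (780 - 9 / 2 * Q ^ 2) * (μ * v) ≤ 668 * (μ * v) := by gcongr; linarith
  have q8 : 668 * (μ * v) - 780 * v ^ 2 ≤ 144 * μ ^ 2 := by
    linarith [sq_nonneg (334 * μ - 780 * v), sq_nonneg μ]
  have q5 : 0 ≤ (780 - 9 / 2 * Q ^ 2) * (μ * v) := mul_nonneg (by linarith) v0
  have q6 : 0 ≤ (195 * Q - 51 / 16 * Q ^ 3) * μ :=
    mul_nonneg (by linarith [mul_nonneg hQ0 (show 0 ≤ 195 - 51 / 16 * Q ^ 2 by linarith)]) hμ0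
  have q7 : (195 * Q - 51 / 16 * Q ^ 3) * μ ≤ 1365 * μ := by
    gcongr
    linarith [pow_nonneg hQ0 3]
  rw [lead, abs_le]
  constructor <;> linarith

/-- Comparison of an alternating sum of values of `partCount` along a quadratic progression with
`boolePoly`. The number `M` is the slope of the progression at its first negative point; since
`μ² + 2 Q z` is constant along the progression, `M` exceeds `√(μ² + 2 Q z)` by at most `Q`. -/
theorem altSum_partCount {Q μ z : ℚ} (hQ5 : 5 ≤ Q) (hQ7 : Q ≤ 7) (hμ : Q / 2 ≤ μ) (hz : 0 ≤ z)
    (hI : 33 ^ 2 ≤ μ ^ 2 + 2 * Q * z) (y : ℕ → ℤ)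
    (hy : ∀ i : ℕ, (y i : ℚ) + 21 = z - μ * i - Q * i ^ 2 / 2) (N : ℕ) (hN : y N < -21) :
    ∃ M : ℚ, 33 ≤ M ∧ (M - Q) ^ 2 ≤ μ ^ 2 + 2 * Q * z ∧
      |1336608 * (∑ i ∈ Finset.range N, (-1) ^ i * (partCount (y i) : ℚ)) - boolePoly Q μ z| ≤
        3 / 2 * M ^ 4 + 1214729 * ((M - μ) / Q) := by
  classical
  have hex : ∃ i, y i < -21 := ⟨N, hN⟩
  -- beyond its first negative term, at `n`, the progression contributes nothing to the sum, and up
  -- to there the quasi-polynomial is valid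
  set n := Nat.find hex with hn
  have hQ0 : 0 < Q := by linarith
  have hμ0 : 0 ≤ μ := by linarith
  have hyn : y n < -21 := Nat.find_spec hex
  have hlt : ∀ i < n, -21 ≤ y i := fun i hi => not_lt.mp (Nat.find_min hex hi)
  have hnN : n ≤ N := Nat.find_min' hex hN
  have hn0 : n ≠ 0 := by
    intro h
    have h1 := hy 0
    rw [h] at hyn
    have h2 : (y 0 : ℚ) < -21 := by exact_mod_cast hyn
    simp only [Nat.cast_zero] at h1
    linarith
  obtain ⟨m, hm⟩ : ∃ m, n = m + 1 := ⟨n - 1, by omega⟩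
  have hzn : z - μ * n - Q * n ^ 2 / 2 < 0 := by
    rw [← hy]
    have h2 : (y n : ℚ) < -21 := by exact_mod_cast hyn
    linarith
  have hzm : 0 ≤ z - μ * m - Q * m ^ 2 / 2 := by
    rw [← hy]
    have h2 : (-21 : ℚ) ≤ (y m : ℚ) := by exact_mod_cast hlt m (by omega)
    linarith
  have hnm : (n : ℚ) = m + 1 := by rw [hm]; push_cast; ring
  have hm0 : (0 : ℚ) ≤ m := m.cast_nonneg
  set M := μ + Q * n with hM
  set w := z - μ * n - Q * n ^ 2 / 2 with hw
  have hMI : M ^ 2 = μ ^ 2 + 2 * Q * z - 2 * Q * w := by rw [hM, hw]; ring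
  have hM33 : 33 ≤ M := by
    have : 0 ≤ M := by positivity
    nlinarith
  have hwM : -M ≤ w := by
    rw [hw, hM, hnm]
    nlinarith
  refine ⟨M, hM33, ?_, ?_⟩
  · have : (M - Q) ^ 2 = μ ^ 2 + 2 * Q * z - 2 * Q * (z - μ * m - Q * m ^ 2 / 2) := by
      rw [hM, hnm]; ring
    rw [this]
    nlinarith
  · have hvan : ∀ i, n ≤ i → y i < 0 := by
      intro i hi
      have h1 : (n : ℚ) ≤ i := by exact_mod_cast hi
      have h2 : (y i : ℚ) < 0 := by
        have := hy i
        have h3 : (y n : ℚ) < -21 := by exact_mod_cast hyn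
        have h4 := hy n
        have h5 : μ * n ≤ μ * i := by gcongr
        have h6 : Q * (n : ℚ) ^ 2 / 2 ≤ Q * i ^ 2 / 2 := by gcongr
        linarith
      exact_mod_cast h2
    have hsum : ∑ i ∈ Finset.range N, (-1) ^ i * (partCount (y i) : ℚ) =
        ∑ i ∈ Finset.range n, (-1) ^ i * (partCount (y i) : ℚ) := by
      symm
      refine Finset.sum_subset (Finset.range_mono hnN) fun i _ hi => ?_
      rw [partCount_of_neg (hvan i (by simpa using hi))]
      simp
    have hval : ∀ i ∈ Finset.range n, 1336608 * ((-1) ^ i * (partCount (y i) : ℚ)) =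
        (-1) ^ i * polyPart (z - μ * i - Q * i ^ 2 / 2) + (-1) ^ i * (periodicPart (y i) : ℚ) := by
      intro i hi
      have h1 := partCount_eq_quasiPoly (n := y i) (by
        have := hlt i (Finset.mem_range.mp hi); omega)
      have h2 : (1336608 * partCount (y i) : ℚ) = (quasiPoly (y i) : ℚ) := by exact_mod_cast h1
      have h3 : (quasiPoly (y i) : ℚ) = polyPart ((y i : ℚ) + 21) + periodicPart (y i) := by
        simp [quasiPoly, polyPart]
      rw [hy] at h3
      rw [← mul_add, ← h3, ← h2]
      ring
    have hT : |∑ i ∈ Finset.range n, (-1) ^ i * (periodicPart (y i) : ℚ)| ≤ 1214729 * n := by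
      refine (Finset.abs_sum_le_sum_abs _ _).trans ?_
      refine (Finset.sum_le_card_nsmul _ _ (1214729 : ℚ) fun i _ => ?_).trans ?_
      · rw [abs_mul, abs_pow, abs_neg, abs_one, one_pow, one_mul]
        exact_mod_cast abs_periodicPart_le (y i)
      · simp [mul_comm]
    have hMn : (M - μ) / Q = n := by rw [hM]; field_simp; ring
    rw [hsum, Finset.mul_sum, Finset.sum_congr rfl hval, Finset.sum_add_distrib, sum_polyPart,
      hMn]
    have hB : |(-1) ^ n * boolePoly Q M w| ≤ 3 / 2 * M ^ 4 := by
      rw [abs_mul, abs_pow, abs_neg, abs_one, one_pow, one_mul]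
      exact abs_boolePoly_le hQ5 hQ7 hM33 hzn.le hwM
    rw [abs_le] at hB hT ⊢
    constructor <;> linarith [hB.1, hB.2, hT.1, hT.2]

/-! ### The exponents of the theta series -/

/-- The exponent `e m = A m² + B m` for `A = a + b / 2` and `B = b / 2`. -/
def expo (a b m : ℕ) : ℕ := a * m ^ 2 + b * (m * (m + 1) / 2)

/-- The difference `(A - B) (2 m + 1)` of the exponents belonging to `-m - 1` and `m`. -/
def gap (a m : ℕ) : ℕ := a * (2 * m + 1)

/-- The difference `e (m + 1) - e m`. -/
def jump (a b m : ℕ) : ℕ := a * (2 * m + 1) + b * (m + 1)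

/-- The pairs `(A - B, 2 B)` in question. -/
def IsAdmissible (a b : ℕ) : Prop :=
  (a = 1 ∧ b = 3) ∨ (a = 2 ∧ b = 1) ∨ (a = 1 ∧ b = 5) ∨ (a = 2 ∧ b = 3)

theorem two_mul_triangle (m : ℕ) : 2 * (m * (m + 1) / 2) = m * (m + 1) :=
  Nat.mul_div_cancel' (Nat.even_mul_succ_self m).two_dvd

theorem cast_expo (a b m : ℕ) :
    (expo a b m : ℚ) = (a + b / 2) * m ^ 2 + b / 2 * m := by
  have h : (2 * (m * (m + 1) / 2 : ℕ) : ℚ) = m * (m + 1) := by exact_mod_cast two_mul_triangle m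
  unfold expo
  push_cast at h ⊢
  linear_combination (b / 2 : ℚ) * h

theorem expo_succ (a b m : ℕ) : expo a b (m + 1) = expo a b m + jump a b m := by
  have h : ((expo a b (m + 1) : ℕ) : ℚ) = ((expo a b m + jump a b m : ℕ) : ℚ) := by
    rw [Nat.cast_add, cast_expo, cast_expo, jump]
    push_cast
    ring
  exact_mod_cast h

theorem expo_mono (a b : ℕ) : Monotone (expo a b) :=
  monotone_nat_of_le_succ fun m => by rw [expo_succ]; omega

theorem le_expo {a b : ℕ} (ha : 0 < a) (m : ℕ) : m ≤ expo a b m := by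
  induction m with
  | zero => simp
  | succ m ih =>
    rw [expo_succ, jump]
    nlinarith

/-! ### Positivity of the main term -/

/-- The difference of the two Boole values exceeds the error terms of `altSum_partCount`; here
`W` bounds the square of the slope at the end of the progression. For small `k`, the coefficients
in `z - 121` of the difference of both sides have nonnegative Bernstein coefficients in
`k ∈ [1, 16]`; for large `k`, that difference has nonnegative coefficients in `k - 16` and
`z - (Q k + 21)`. -/
theorem boolePoly_sub_gt {a b : ℕ} (hab : IsAdmissible a b) {k z Q μ W : ℚ} (hk : 1 ≤ k)
    (hz : 121 ≤ z) (hkz : Q * k + 21 ≤ z) (hQ : Q = 2 * a + b) (hμ : μ = Q * k + b / 2)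
    (hW : W = 6 / 5 * (μ ^ 2 + 2 * Q * z) + 6 * Q ^ 2) :
    3 * W ^ 2 + 2 * 1214729 * ((W + 2500) / (100 * Q)) <
      boolePoly Q μ z - boolePoly Q (μ + 2 * a) (z - a * (2 * k + 1)) := by
  rcases le_total k 16 with hk16 | hk16
  · obtain ⟨u, rfl⟩ : ∃ u : ℚ, z = 121 + u := ⟨z - 121, by ring⟩
    have hu : 0 ≤ u := by linarith
    have hv : 0 ≤ k - 1 := by linarith
    have hw : 0 ≤ 16 - k := by linarith
    clear hkz
    have bern : ∀ j l m : ℕ, 0 ≤ u ^ j * ((k - 1) ^ l * (16 - k) ^ m) := fun j l m => by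
      positivity
    have b40 := bern 0 4 0
    have b31 := bern 0 3 1
    have b22 := bern 0 2 2
    have b13 := bern 0 1 3
    have b04 := bern 0 0 4
    have c30 := bern 1 3 0
    have c21 := bern 1 2 1
    have c12 := bern 1 1 2
    have c03 := bern 1 0 3
    have d20 := bern 2 2 0
    have d11 := bern 2 1 1
    have d02 := bern 2 0 2
    have e10 := bern 3 1 0
    have e01 := bern 3 0 1
    clear bern
    rcases hab with ⟨rfl, rfl⟩ | ⟨rfl, rfl⟩ | ⟨rfl, rfl⟩ | ⟨rfl, rfl⟩ <;>
    · norm_num at hQ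
      subst hQ hμ hW
      unfold boolePoly
      push_cast
      linarith
  · obtain ⟨j, rfl⟩ : ∃ j : ℚ, k = 16 + j := ⟨k - 16, by ring⟩
    obtain ⟨u, rfl⟩ : ∃ u : ℚ, z = Q * (16 + j) + 21 + u := ⟨z - (Q * (16 + j) + 21), by ring⟩
    have hu : 0 ≤ u := by linarith
    have hj : 0 ≤ j := by linarith
    clear hz hkz
    rw [← sub_pos]
    rcases hab with ⟨rfl, rfl⟩ | ⟨rfl, rfl⟩ | ⟨rfl, rfl⟩ | ⟨rfl, rfl⟩ <;>
    · norm_num at hQ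
      subst hQ hμ hW
      unfold boolePoly
      push_cast
      ring_nf
      positivity

/-! ### The recursion for the truncated theta series -/

theorem exponent_eq_natCast {a b : ℕ} (j n : ℕ) :
    ((a : ℚ) + b / 2) * (((j : ℕ) : ℤ) : ℚ) ^ 2 + b / 2 * (((j : ℕ) : ℤ) : ℚ) = n ↔
      expo a b j = n := by
  have := cast_expo a b j
  constructor
  · intro h
    have : (expo a b j : ℚ) = n := by rw [this, ← h]; norm_cast
    exact_mod_cast this
  · rintro rfl
    rw [this]
    norm_cast

theorem exponent_eq_neg {a b : ℕ} (j n : ℕ) :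
    ((a : ℚ) + b / 2) * ((-(j : ℤ) - 1 : ℤ) : ℚ) ^ 2 + b / 2 * ((-(j : ℤ) - 1 : ℤ) : ℚ) = n ↔
      expo a b j + gap a j = n := by
  have h1 : ((a : ℚ) + b / 2) * ((-(j : ℤ) - 1 : ℤ) : ℚ) ^ 2 + b / 2 * ((-(j : ℤ) - 1 : ℤ) : ℚ) =
      (expo a b j + gap a j : ℕ) := by
    rw [Nat.cast_add, cast_expo, gap]
    push_cast
    ring
  rw [h1]
  norm_cast

theorem coeff_thetaTail_eq_zero {a b k n : ℕ} (h : n < expo a b k) :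
    coeff n (thetaTail (a + b / 2) (b / 2) k) = 0 := by
  rw [thetaTail, coeff_mk]
  have : tailIndices (a + b / 2) (b / 2) k n = ∅ := by
    rw [Set.eq_empty_iff_forall_notMem]
    rintro j ⟨hj, he⟩
    rw [Set.mem_Icc, not_and_or, not_le, not_le] at hj
    rcases le_or_gt 0 j with h0 | h0
    · lift j to ℕ using h0
      rw [exponent_eq_natCast] at he
      have := expo_mono a b (show k ≤ j by omega)
      omega
    · obtain ⟨m, rfl⟩ : ∃ m : ℕ, j = -(m : ℤ) - 1 := ⟨(-j - 1).toNat, by omega⟩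
      rw [exponent_eq_neg] at he
      have := expo_mono a b (show k ≤ m by omega)
      omega
  rw [this]
  simp

theorem thetaTail_add_succ {a b : ℕ} (ha : 0 < a) (k : ℕ) :
    thetaTail (a + b / 2) (b / 2) k + thetaTail (a + b / 2) (b / 2) (k + 1) =
      X ^ expo a b k - X ^ (expo a b k + gap a k) := by
  ext n
  have hA : (b / 2 : ℚ) < a + b / 2 := by
    have : (0 : ℚ) < a := by exact_mod_cast ha
    linarith
  have hfin := fun k => tailIndices_finite (a + b / 2) (b / 2) (by positivity) hA k n
  rw [map_add, map_sub, coeff_X_pow, coeff_X_pow, thetaTail, thetaTail, coeff_mk, coeff_mk,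
    finsum_mem_def, finsum_mem_def, ← finsum_add_distrib
      ((hfin k).subset (Set.support_indicator_subset))
      ((hfin (k + 1)).subset (Set.support_indicator_subset))]
  rw [finsum_eq_sum_of_support_subset (s := {(k : ℤ), -(k : ℤ) - 1})]
  · rw [Finset.sum_pair (by omega)]
    simp only [Set.indicator, tailIndices, Set.mem_ofPred_eq, Set.mem_Icc, exponent_eq_neg,
      exponent_eq_natCast]
    have e1 : ((k : ℤ) + k).negOnePow = 1 := Int.negOnePow_even _ ⟨k, rfl⟩
    have e2 : (-(k : ℤ) - 1 + k).negOnePow = -1 := Int.negOnePow_odd _ ⟨-1, by ring⟩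
    rw [e1, e2]
    have c1 : ¬ (-(k : ℤ) ≤ k ∧ (k : ℤ) ≤ k - 1) := by omega
    have c2 : ¬ (-(k : ℤ) ≤ -k - 1 ∧ -(k : ℤ) - 1 ≤ k - 1) := by omega
    have c3 : (-((k + 1 : ℕ) : ℤ) ≤ k ∧ (k : ℤ) ≤ ((k + 1 : ℕ) : ℤ) - 1) := by omega
    have c4 : (-((k + 1 : ℕ) : ℤ) ≤ -k - 1 ∧ -(k : ℤ) - 1 ≤ ((k + 1 : ℕ) : ℤ) - 1) := by omega
    simp only [c1, c2, c3, c4, not_true, not_false_eq_true, true_and, false_and, if_false,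
      add_zero, eq_comm (a := n)]
    split_ifs <;> simp
  · intro j hj
    simp only [Finset.coe_insert, Finset.coe_singleton, Set.mem_insert_iff,
      Set.mem_singleton_iff]
    by_contra hne
    rw [not_or] at hne
    apply hj
    have hmem : j ∈ tailIndices (a + b / 2) (b / 2) (k + 1) n ↔
        j ∈ tailIndices (a + b / 2) (b / 2) k n := by
      simp only [tailIndices, Set.mem_ofPred_eq, Set.mem_Icc]
      refine and_congr_left fun _ => ?_
      push_cast
      omega
    have hsign : (j + ((k + 1 : ℕ) : ℤ)).negOnePow = -(j + (k : ℤ)).negOnePow := by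
      rw [Nat.cast_add, Nat.cast_one, ← add_assoc, Int.negOnePow_succ]
    beta_reduce
    by_cases hj' : j ∈ tailIndices (a + b / 2) (b / 2) k n
    · rw [Set.indicator_of_mem hj', Set.indicator_of_mem (hmem.mpr hj'), hsign]
      simp
    · rw [Set.indicator_of_notMem hj', Set.indicator_of_notMem (mt hmem.mp hj'), add_zero]

theorem partSeries_mul_coeff (a b k n : ℕ) :
    coeff n (partSeries * (X ^ expo a b k - X ^ (expo a b k + gap a k))) =
      partCount (n - expo a b k) - partCount (n - expo a b k - gap a k) := by
  rw [← extCoeff_natCast, mul_sub, extCoeff_natCast, map_sub, ← extCoeff_natCast,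
    ← extCoeff_natCast, extCoeff_mul_X_pow, extCoeff_mul_X_pow, partCount]
  push_cast
  rw [sub_sub]

theorem gammaCoeff_add_succ {a b : ℕ} (ha : 0 < a) (k n : ℕ) :
    gammaCoeff {2, 3, 7, 13, 17} (a + b / 2) (b / 2) k n +
      gammaCoeff {2, 3, 7, 13, 17} (a + b / 2) (b / 2) (k + 1) n =
      partCount (n - expo a b k) - partCount (n - expo a b k - gap a k) := by
  rw [← partSeries_mul_coeff, ← thetaTail_add_succ ha, mul_add, map_add]
  rfl

theorem gammaCoeff_eq_zero {a b k n : ℕ} (h : n < expo a b k) :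
    gammaCoeff {2, 3, 7, 13, 17} (a + b / 2) (b / 2) k n = 0 := by
  have h1 : X ^ expo a b k ∣ thetaTail (a + b / 2) (b / 2) k :=
    X_pow_dvd_iff.mpr fun m hm => coeff_thetaTail_eq_zero hm
  exact X_pow_dvd_iff.mp (h1.mul_left _) n h

/-! ### Power series with nonnegative coefficients -/

/-- All coefficients are nonnegative. -/
def CoeffNonneg (f : PowerSeries ℤ) : Prop := ∀ n, 0 ≤ coeff n f

theorem CoeffNonneg.mul {f g : PowerSeries ℤ} (hf : CoeffNonneg f) (hg : CoeffNonneg g) :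
    CoeffNonneg (f * g) := fun n => by
  rw [coeff_mul]
  exact Finset.sum_nonneg fun p _ => mul_nonneg (hf _) (hg _)

theorem CoeffNonneg.add {f g : PowerSeries ℤ} (hf : CoeffNonneg f) (hg : CoeffNonneg g) :
    CoeffNonneg (f + g) := fun n => by
  rw [map_add]
  exact add_nonneg (hf n) (hg n)

theorem coeffNonneg_X_pow (s : ℕ) : CoeffNonneg (X ^ s) := fun n => by
  rw [coeff_X_pow]
  split_ifs <;> simp

theorem coeffNonneg_recip_one_sub_X_pow {s : ℕ} (hs : s ≠ 0) :
    CoeffNonneg (recip (1 - X ^ s)) := by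
  intro n
  induction n using Nat.strong_induction_on with
  | _ n ih =>
    have h := one_sub_X_pow_mul_recip hs
    have h1 : recip (1 - (X : PowerSeries ℤ) ^ s) = 1 + X ^ s * recip (1 - X ^ s) := by
      linear_combination h
    rw [h1, map_add, coeff_one, coeff_X_pow_mul']
    refine add_nonneg (by split_ifs <;> simp) ?_
    split_ifs with hsn
    · exact ih _ (by omega)
    · exact le_rfl

theorem coeffNonneg_prod {ι : Type*} (s : Finset ι) (f : ι → PowerSeries ℤ)
    (hf : ∀ i ∈ s, CoeffNonneg (f i)) : CoeffNonneg (∏ i ∈ s, f i) := by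
  classical
  induction s using Finset.induction_on with
  | empty => simpa using coeffNonneg_X_pow 0
  | insert i s hi ih =>
    rw [Finset.prod_insert hi]
    exact (hf i (by simp)).mul (ih fun j hj => hf j (by simp [hj]))

theorem coeffNonneg_one_sub_mul_partSeries {s : ℕ} (hs : s ∈ ({2, 3, 7, 13, 17} : Finset ℕ)) :
    CoeffNonneg ((1 - X ^ s) * partSeries) := by
  have h0 : ∀ t ∈ ({2, 3, 7, 13, 17} : Finset ℕ), t ≠ 0 := by decide
  rw [partSeries, ← Finset.mul_prod_erase _ _ hs, ← mul_assoc,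
    one_sub_X_pow_mul_recip (h0 s hs), one_mul]
  exact coeffNonneg_prod _ _ fun t ht =>
    coeffNonneg_recip_one_sub_X_pow (h0 t (Finset.mem_of_mem_erase ht))

/-- Every `c ≥ 2` is a sum of elements of `{2, 3}`, and
`1 - q ^ (c + 2) = (1 - q ^ c) + q ^ c (1 - q ^ 2)`. -/
theorem coeffNonneg_one_sub_X_pow_mul_partSeries :
    ∀ c : ℕ, CoeffNonneg ((1 - X ^ (c + 2)) * partSeries)
  | 0 => coeffNonneg_one_sub_mul_partSeries (by decide)
  | 1 => coeffNonneg_one_sub_mul_partSeries (by decide)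
  | c + 2 => by
    have e : (1 - X ^ (c + 2 + 2)) * partSeries = (1 - X ^ (c + 2)) * partSeries +
        X ^ (c + 2) * ((1 - X ^ 2) * partSeries) := by ring
    rw [e]
    exact (coeffNonneg_one_sub_X_pow_mul_partSeries c).add
      ((coeffNonneg_X_pow _).mul (coeffNonneg_one_sub_mul_partSeries (by decide)))

theorem partCount_sub_nonneg {c : ℕ} (hc : 2 ≤ c) (n : ℤ) :
    0 ≤ partCount n - partCount (n - c) := by
  obtain ⟨d, rfl⟩ : ∃ d, c = d + 2 := ⟨c - 2, by omega⟩
  have h := coeffNonneg_one_sub_X_pow_mul_partSeries d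
  rw [mul_comm] at h
  change 0 ≤ bdiff (d + 2) partCount n
  rw [partCount, ← extCoeff_mul_one_sub, extCoeff]
  split_ifs
  · exact h _
  · exact le_rfl

theorem CoeffNonneg.hasNatCoeffs {f : PowerSeries ℤ} (hf : CoeffNonneg f) : HasNatCoeffs f :=
  ⟨mk fun n => (coeff n f).toNat, by ext n; simp [hf n]⟩

/-! ### The reciprocal of an infinite `q`-shifted factorial -/

theorem qPochInf_eq_mul (a p : PowerSeries ℤ) (hp : constantCoeff p = 0) :
    qPochInf a p = (1 - a) * qPochInf (a * p) p := by
  have e : ∀ i : ℕ, 1 - a * p * p ^ i = 1 - a * p ^ (i + 1) := fun i => by ring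
  have h := multipliable_qPochInf (a * p) p hp
  simp only [e] at h
  have key : ∏' i : ℕ, (1 - a * p ^ i) = (1 - a * p ^ 0) * ∏' i : ℕ, (1 - a * p ^ (i + 1)) :=
    tprod_eq_zero_mul' (f := fun i : ℕ => 1 - a * p ^ i) h
  rw [pow_zero, mul_one] at key
  simp only [qPochInf, e]
  exact key

theorem X_pow_dvd_qPochInf_sub_one {a p : PowerSeries ℤ} (hp : constantCoeff p = 0) {N : ℕ}
    (ha : X ^ N ∣ a) : X ^ N ∣ qPochInf a p - 1 := by
  have h := (multipliable_qPochInf a p hp).hasProd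
  have hfin : ∀ s : Finset ℕ, X ^ N ∣ (∏ i ∈ s, (1 - a * p ^ i)) - 1 := by
    intro s
    induction s using Finset.induction_on with
    | empty => simp
    | insert i s hi ih =>
      rw [Finset.prod_insert hi]
      have e : (1 - a * p ^ i) * (∏ j ∈ s, (1 - a * p ^ j)) - 1 =
          ((∏ j ∈ s, (1 - a * p ^ j)) - 1) - a * (p ^ i * ∏ j ∈ s, (1 - a * p ^ j)) := by ring
      rw [e]
      exact ih.sub (ha.mul_right _)
  rw [X_pow_dvd_iff]
  intro m hm
  rw [map_sub, sub_eq_zero]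
  have hc := ((PowerSeries.WithPiTopology.continuous_coeff ℤ m).tendsto _).comp h
  refine tendsto_nhds_unique hc (tendsto_const_nhds.congr fun s => ?_)
  have := X_pow_dvd_iff.mp (hfin s) m hm
  rw [map_sub, sub_eq_zero] at this
  exact this.symm

theorem recip_mul {f g : PowerSeries ℤ} (hf : constantCoeff f = 1) (hg : constantCoeff g = 1) :
    recip (f * g) = recip f * recip g := by
  have h1 := mul_recip f hf
  have h2 := mul_recip g hg
  have h3 := mul_recip (f * g) (by simp [hf, hg])
  calc recip (f * g) = (f * recip f) * (g * recip g) * recip (f * g) := by rw [h1, h2]; ring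
    _ = (f * g * recip (f * g)) * (recip f * recip g) := by ring
    _ = recip f * recip g := by rw [h3, one_mul]

/-- The coefficient of `q ^ n` in `1 / (q^c; q^d)_∞` only involves the factors with exponent at
most `n`; splitting off one factor at a time reduces to the case `n < c`. -/
theorem coeffNonneg_recip_qPochInf {d : ℕ} (hd : d ≠ 0) {c : ℕ} (hc : c ≠ 0) :
    CoeffNonneg (recip (qPochInf (X ^ c) (X ^ d))) := by
  have hX : constantCoeff ((X : PowerSeries ℤ) ^ d) = 0 := by simp [hd]
  have key : ∀ n t c : ℕ, c ≠ 0 → n < c + t →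
      ∀ m ≤ n, 0 ≤ coeff m (recip (qPochInf (X ^ c) (X ^ d))) := by
    intro n t
    induction t with
    | zero =>
      intro c hc hn m hm
      have hcc : constantCoeff (qPochInf ((X : PowerSeries ℤ) ^ c) (X ^ d)) = 1 :=
        constantCoeff_qPochInf _ _ (by simp [hc]) hX
      have h1 := mul_recip _ hcc
      have h2 := X_pow_dvd_qPochInf_sub_one hX (dvd_refl ((X : PowerSeries ℤ) ^ c))
      have h3 : X ^ c ∣ recip (qPochInf (X ^ c) (X ^ d)) - 1 := by
        have e : recip (qPochInf (X ^ c) (X ^ d)) - 1 =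
            -((qPochInf (X ^ c) (X ^ d) - 1) * recip (qPochInf (X ^ c) (X ^ d))) := by
          linear_combination h1
        rw [e]
        exact (h2.mul_right _).neg_right
      have h4 := X_pow_dvd_iff.mp h3 m (by omega)
      rw [map_sub, sub_eq_zero] at h4
      rw [h4, coeff_one]
      split_ifs <;> simp
    | succ t ih =>
      intro c hc hn m hm
      rw [qPochInf_eq_mul _ _ hX, ← pow_add, recip_mul (by simp [hc])
        (constantCoeff_qPochInf _ _ (by simp [hc]) hX), coeff_mul]
      refine Finset.sum_nonneg fun p hp => mul_nonneg
        (coeffNonneg_recip_one_sub_X_pow hc _) (ih (c + d) (by omega) (by omega) _ ?_)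
      have := Finset.HasAntidiagonal.mem_antidiagonal.mp hp
      omega
  exact fun n => key n (n + 1) c hc (by omega) n le_rfl

/-! ### The large exponents, by Boole summation -/

/-- The `N`-fold unrolled recursion for a family satisfying the recursion of `gammaCoeff`. -/
theorem unroll_recursion (a b : ℕ) (G : ℕ → ℕ → ℤ)
    (hrec : ∀ k n : ℕ, G k n + G (k + 1) n =
      partCount (n - expo a b k) - partCount (n - expo a b k - gap a k)) (k n N : ℕ) :
    G k n = ∑ i ∈ Finset.range N, (-1) ^ i * partCount (n - expo a b (k + i)) -
      ∑ i ∈ Finset.range N, (-1) ^ i * partCount (n - expo a b (k + i) - gap a (k + i)) +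
        (-1) ^ N * G (k + N) n := by
  induction N with
  | zero => simp
  | succ N ih =>
    rw [ih, Finset.sum_range_succ, Finset.sum_range_succ, ← add_assoc, pow_succ]
    linear_combination (-1) ^ N * hrec (k + N) n

/-- Unrolling the recursion gives two alternating sums of values of `partCount`, over the
exponents `e m` and `e m + gap a m`. Both run along progressions with the same second difference
`Q` and the same invariant `μ² + 2 Q z`, so that `altSum_partCount` applies to both with the same
error bound. -/
theorem nonneg_of_recursion_of_large {a b : ℕ} (hab : IsAdmissible a b) {G : ℕ → ℕ → ℤ}
    (hrec : ∀ k n : ℕ, G k n + G (k + 1) n =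
      partCount (n - expo a b k) - partCount (n - expo a b k - gap a k))
    (hzero : ∀ k n : ℕ, n < expo a b k → G k n = 0) {k x : ℕ} (hk : 1 ≤ k) (hx : 100 ≤ x)
    (hkx : jump a b k ≤ x) : 0 ≤ G k (expo a b k + x) := by
  have ha : 0 < a := by rcases hab with h | h | h | h <;> omega
  set n := expo a b k + x with hn
  -- `e m ≥ m`, so that the first argument beyond the sum is below `-21`
  set N := n + 22 with hN
  have hsum := unroll_recursion a b G hrec k n N
  have hexpo : n + 22 ≤ expo a b (k + N) := by
    have := le_expo (b := b) ha (k + N)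
    omega
  rw [hzero (k + N) n (by omega), mul_zero, add_zero] at hsum
  set Q : ℚ := 2 * a + b with hQ
  set μ : ℚ := Q * k + b / 2 with hμ
  set z : ℚ := x + 21 with hz
  have hQ5 : 5 ≤ Q := by
    rcases hab with ⟨h, h'⟩ | ⟨h, h'⟩ | ⟨h, h'⟩ | ⟨h, h'⟩ <;> norm_num [hQ, h, h']
  have hQ7 : Q ≤ 7 := by
    rcases hab with ⟨h, h'⟩ | ⟨h, h'⟩ | ⟨h, h'⟩ | ⟨h, h'⟩ <;> norm_num [hQ, h, h']
  have hk' : (1 : ℚ) ≤ k := by exact_mod_cast hk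
  have hx' : (100 : ℚ) ≤ x := by exact_mod_cast hx
  have ha' : (0 : ℚ) < a := by exact_mod_cast ha
  have hb' : (0 : ℚ) ≤ b := b.cast_nonneg
  have hjump : Q * k + a + b ≤ x := by
    have : (jump a b k : ℚ) ≤ x := by exact_mod_cast hkx
    rw [jump] at this
    push_cast at this
    rw [hQ]
    linarith
  have hgap : (gap a k : ℚ) = a * (2 * k + 1) := by rw [gap]; push_cast; ring
  have hgapx : (gap a k : ℚ) ≤ x := by
    rw [hgap]
    have : 0 ≤ (b : ℚ) * k := by positivity
    rw [hQ] at hjump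
    linarith
  have hQk : 5 ≤ Q * k := by nlinarith
  have hμQ : Q / 2 ≤ μ := by rw [hμ]; nlinarith
  have hI : 33 ^ 2 ≤ μ ^ 2 + 2 * Q * z := by
    have : 5 * 121 ≤ Q * z := by gcongr; linarith
    nlinarith [sq_nonneg μ]
  have hI2 : (μ + 2 * a) ^ 2 + 2 * Q * (z - gap a k) = μ ^ 2 + 2 * Q * z := by
    rw [hgap, hμ, hQ]; ring
  obtain ⟨M₁, hM₁, hMI₁, hB₁⟩ := altSum_partCount (Q := Q) (μ := μ) (z := z) hQ5 hQ7 hμQ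
    (by linarith) hI (fun i => (n : ℤ) - expo a b (k + i)) (fun i => by
      push_cast
      rw [cast_expo, hn, Nat.cast_add, cast_expo, hz, hμ, hQ]
      push_cast
      ring) N (by omega)
  obtain ⟨M₂, hM₂, hMI₂, hB₂⟩ := altSum_partCount (Q := Q) (μ := μ + 2 * a) (z := z - gap a k)
    hQ5 hQ7 (by linarith) (by linarith) (by rw [hI2]; exact hI)
    (fun i => (n : ℤ) - expo a b (k + i) - gap a (k + i)) (fun i => by
      push_cast
      rw [cast_expo, hn, Nat.cast_add, cast_expo, hz, hμ, hQ, gap, gap]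
      push_cast
      ring) N (by omega)
  rw [hI2] at hMI₂
  set I := μ ^ 2 + 2 * Q * z with hIdef
  set W := 6 / 5 * I + 6 * Q ^ 2 with hW
  have hmain := boolePoly_sub_gt hab (k := k) (z := z) (W := W) hk' (by linarith)
    (by linarith) hQ hμ (by rw [hW, hIdef])
  -- `M² ≤ (6 / 5) (M - Q)² + 6 Q²` and `100 M ≤ M² + 2500` replace `M` by `W` in the error terms
  have herr : ∀ M ν : ℚ, 33 ≤ M → Q / 2 ≤ ν → (M - Q) ^ 2 ≤ I →
      3 / 2 * M ^ 4 + 1214729 * ((M - ν) / Q) ≤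
        3 / 2 * W ^ 2 + 1214729 * ((W + 2500) / (100 * Q)) := by
    intro M ν hM hν hMI
    have h1 : M ^ 2 ≤ W := by
      rw [hW]
      linarith [sq_nonneg (M - 6 * Q)]
    have h2 : M ^ 4 ≤ W ^ 2 := by
      calc M ^ 4 = (M ^ 2) ^ 2 := by ring
        _ ≤ W ^ 2 := by gcongr
    have h3 : (M - ν) / Q ≤ (W + 2500) / (100 * Q) := by
      rw [div_le_div_iff₀ (by linarith) (by linarith)]
      have : 100 * (M - ν) ≤ W + 2500 := by linarith [sq_nonneg (M - 50)]
      calc (M - ν) * (100 * Q) = 100 * (M - ν) * Q := by ring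
        _ ≤ (W + 2500) * Q := by gcongr
    linarith
  have e₁ := herr M₁ μ hM₁ hμQ hMI₁
  have e₂ := herr M₂ (μ + 2 * a) hM₂ (by linarith) hMI₂
  rw [abs_le] at hB₁ hB₂
  rw [hgap] at hB₂
  have hcast : (G k n : ℚ) =
      ∑ i ∈ Finset.range N, (-1) ^ i * (partCount ((n : ℤ) - expo a b (k + i)) : ℚ) -
      ∑ i ∈ Finset.range N,
        (-1) ^ i * (partCount ((n : ℤ) - expo a b (k + i) - gap a (k + i)) : ℚ) := by
    rw [hsum]
    push_cast
    rfl
  have : (0 : ℚ) ≤ G k n := by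
    rw [hcast]
    linarith [hB₁.1, hB₂.2]
  exact_mod_cast this

/-! ### The small exponents, by computation -/

/-- The values `partCount n` for `n < 100`. -/
def smallCounts : List ℤ :=
  [1, 0, 1, 1, 1, 1, 2, 2, 2, 3, 3, 3, 4, 5, 5, 6, 7, 8, 8, 10, 11, 12, 13, 15, 16, 17, 20,
   21, 23, 25, 28, 29, 32, 35, 38, 40, 44, 47, 50, 54, 58, 62, 66, 71, 75, 80, 85, 91, 96,
   102, 108, 115, 121, 128, 136, 143, 151, 159, 168, 176, 186, 195, 205, 215, 226, 237, 248,
   260, 273, 285, 298, 312, 326, 340, 355, 371, 386, 403, 420, 437, 455, 474, 493, 512, 533,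
   554, 575, 597, 620, 643, 667, 692, 717, 743, 770, 797, 825, 854, 884, 914]

theorem smallCounts_getD {x : ℕ} (hx : x < 100) : smallCounts.getD x 0 = partCount x := by
  have h := partCount_eq_quasiPoly (n := (x : ℤ)) (by omega)
  have key : ∀ i : Fin 100, 1336608 * smallCounts.getD i 0 = quasiPoly (i : ℕ) := by
    decide +kernel
  have := key ⟨x, hx⟩
  simp only at this
  omega

/-- The value at `y` of a list, extended by zero to negative and large arguments. -/
def lookup (T : List ℤ) : ℤ → ℤ
  | Int.ofNat x => T.getD x 0
  | Int.negSucc _ => 0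

/-- The value `G k (expo a b k + x)` for a family satisfying the recursion of `gammaCoeff`,
computed from the table `T` of values of `partCount`; the first argument bounds the depth of the
recursion. -/
def computeG (T : List ℤ) (a b : ℕ) : ℕ → ℕ → ℤ → ℤ
  | 0, _, _ => 0
  | _ + 1, _, Int.negSucc _ => 0
  | d + 1, k, Int.ofNat x =>
    lookup T x - lookup T (x - gap a k) - computeG T a b d (k + 1) (x - jump a b k)

theorem lookup_smallCounts {y : ℤ} (hy : y < 100) : lookup smallCounts y = partCount y := by
  cases y with
  | ofNat x => exact smallCounts_getD (by simpa using hy)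
  | negSucc x => exact (partCount_of_neg (Int.negSucc_lt_zero x)).symm

theorem computeG_eq {a b : ℕ} (ha : 0 < a) {G : ℕ → ℕ → ℤ}
    (hrec : ∀ k n : ℕ, G k n + G (k + 1) n =
      partCount (n - expo a b k) - partCount (n - expo a b k - gap a k))
    (hzero : ∀ k n : ℕ, n < expo a b k → G k n = 0) (d k n : ℕ)
    (hn : n < expo a b k + 100) (hd : n < expo a b k + d) :
    computeG smallCounts a b d k (n - expo a b k) = G k n := by
  induction d generalizing k with
  | zero => rw [computeG, hzero k n (by omega)]
  | succ d ih =>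
    have hj : 0 < jump a b k := by unfold jump; positivity
    have he := expo_succ a b k
    by_cases h : n < expo a b k
    · obtain ⟨m, hm⟩ := Int.eq_negSucc_of_lt_zero (show (n : ℤ) - expo a b k < 0 by omega)
      rw [hm, computeG, hzero k n h]
    · obtain ⟨x, rfl⟩ := Nat.exists_eq_add_of_le (not_lt.mp h)
      have e1 : ((expo a b k + x : ℕ) : ℤ) - expo a b k = x := by simp
      have e2 : (x : ℤ) - jump a b k = ((expo a b k + x : ℕ) : ℤ) - expo a b (k + 1) := by
        rw [he]
        push_cast
        ring
      have hr := hrec k (expo a b k + x)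
      rw [e1] at hr ⊢
      change computeG smallCounts a b (d + 1) k (Int.ofNat x) = _
      rw [computeG, e2, ih (k + 1) (by omega) (by omega), lookup_smallCounts (by omega),
        lookup_smallCounts (by omega)]
      linarith

/-- Nonnegativity of `computeG` on the range that the estimates leave open. -/
def smallCheck (a b : ℕ) : Bool :=
  (List.range 19).all fun k => (List.range 100).all fun x =>
    decide (0 ≤ computeG smallCounts a b 100 (k + 1) (Int.ofNat x))

theorem smallCheck_of_isAdmissible {a b : ℕ} (hab : IsAdmissible a b) :
    smallCheck a b = true := by
  rcases hab with ⟨rfl, rfl⟩ | ⟨rfl, rfl⟩ | ⟨rfl, rfl⟩ | ⟨rfl, rfl⟩ <;> decide +kernel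

/-! ### Nonnegativity of the coefficients -/

/-- The recursion of `gammaCoeff`, together with the vanishing below `expo a b k`, forces
nonnegativity for all `k ≥ 1`. -/
theorem nonneg_of_recursion {a b : ℕ} (hab : IsAdmissible a b) {G : ℕ → ℕ → ℤ}
    (hrec : ∀ k n : ℕ, G k n + G (k + 1) n =
      partCount (n - expo a b k) - partCount (n - expo a b k - gap a k))
    (hzero : ∀ k n : ℕ, n < expo a b k → G k n = 0) {k : ℕ} (hk : 1 ≤ k) (n : ℕ) :
    0 ≤ G k n := by
  have ha : 0 < a := by rcases hab with h | h | h | h <;> omega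
  by_cases h : n < expo a b k
  · exact (hzero k n h).ge
  obtain ⟨x, rfl⟩ := Nat.exists_eq_add_of_le (not_lt.mp h)
  by_cases hx : x < jump a b k
  · -- only one term is left, and `gap a k ≥ 2` since `k ≥ 1`
    have h1 := hrec k (expo a b k + x)
    rw [hzero (k + 1) _ (by rw [expo_succ]; omega), add_zero] at h1
    rw [h1]
    exact partCount_sub_nonneg (by unfold gap; nlinarith) _
  by_cases hx100 : x < 100
  · have hk20 : k < 20 := by
      unfold jump at hx
      rcases hab with ⟨rfl, rfl⟩ | ⟨rfl, rfl⟩ | ⟨rfl, rfl⟩ | ⟨rfl, rfl⟩ <;> omega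
    have hc := smallCheck_of_isAdmissible hab
    simp only [smallCheck, List.all_eq_true, List.mem_range, decide_eq_true_eq] at hc
    have h1 := hc (k - 1) (by omega) x hx100
    rw [Nat.sub_add_cancel hk] at h1
    rw [← computeG_eq ha hrec hzero 100 k _ (by omega) (by omega)]
    have e1 : ((expo a b k + x : ℕ) : ℤ) - expo a b k = Int.ofNat x := by simp
    rwa [e1]
  · exact nonneg_of_recursion_of_large hab hrec hzero hk (by omega) (by omega)

theorem gammaCoeff_nonneg {a b : ℕ} (hab : IsAdmissible a b) {k : ℕ} (hk : 1 ≤ k) (n : ℕ) :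
    0 ≤ gammaCoeff {2, 3, 7, 13, 17} (a + b / 2) (b / 2) k n :=
  have ha : 0 < a := by rcases hab with h | h | h | h <;> omega
  nonneg_of_recursion hab (G := gammaCoeff {2, 3, 7, 13, 17} (a + b / 2) (b / 2))
    (gammaCoeff_add_succ ha) (fun _ _ => gammaCoeff_eq_zero) hk n

/-! ### The reciprocal of `(q², q³; q⁵)_∞` -/

theorem recip_qPochInf_split (c d : ℕ) (hc : c ≠ 0) (hd : d ≠ 0) :
    recip (qPochInf ((X : PowerSeries ℤ) ^ c) (X ^ d)) =
      recip (1 - X ^ c) * recip (qPochInf (X ^ (c + d)) (X ^ d)) := by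
  have hX : constantCoeff ((X : PowerSeries ℤ) ^ d) = 0 := by simp [hd]
  rw [qPochInf_eq_mul _ _ hX, ← pow_add,
    recip_mul (by simp [hc]) (constantCoeff_qPochInf _ _ (by simp [hc]) hX)]

/-- The factors `1 - q ^ s` with `s ∈ {2, 3, 7, 13, 17}` all occur in `(q², q³; q⁵)_∞`. -/
theorem recip_qPochInf_eq_partSeries_mul :
    ∃ R : PowerSeries ℤ, CoeffNonneg R ∧
      recip (qPochInf ((X : PowerSeries ℤ) ^ 2) (X ^ 5) * qPochInf (X ^ 3) (X ^ 5)) =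
        partSeries * R := by
  have hX : constantCoeff ((X : PowerSeries ℤ) ^ 5) = 0 := by simp
  refine ⟨recip (1 - X ^ 12) * recip (1 - X ^ 8) * recip (qPochInf (X ^ 22) (X ^ 5)) *
    recip (qPochInf (X ^ 18) (X ^ 5)), ?_, ?_⟩
  · exact (((coeffNonneg_recip_one_sub_X_pow (by norm_num)).mul
      (coeffNonneg_recip_one_sub_X_pow (by norm_num))).mul
      (coeffNonneg_recip_qPochInf (by norm_num) (by norm_num))).mul
      (coeffNonneg_recip_qPochInf (by norm_num) (by norm_num))
  · rw [recip_mul (constantCoeff_qPochInf _ _ (by simp) hX)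
      (constantCoeff_qPochInf _ _ (by simp) hX),
      recip_qPochInf_split 2 5 (by norm_num) (by norm_num),
      recip_qPochInf_split 7 5 (by norm_num) (by norm_num),
      recip_qPochInf_split 12 5 (by norm_num) (by norm_num),
      recip_qPochInf_split 17 5 (by norm_num) (by norm_num),
      recip_qPochInf_split 3 5 (by norm_num) (by norm_num),
      recip_qPochInf_split 8 5 (by norm_num) (by norm_num),
      recip_qPochInf_split 13 5 (by norm_num) (by norm_num)]
    simp only [partSeries, Finset.mem_insert, Finset.mem_singleton, not_false_eq_true,
      Finset.prod_insert, Finset.prod_singleton, or_self, Nat.reduceEqDiff,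
      Nat.reduceAdd]
    ring

end TruncatedTheta

theorem mainTheorem4 (A B : ℚ)
    (hAB : (A, B) ∈ ({(5 / 2, 3 / 2), (5 / 2, 1 / 2), (7 / 2, 5 / 2), (7 / 2, 3 / 2)} :
      Set (ℚ × ℚ))) :
    (∀ k : ℕ, 1 ≤ k → ∀ n : ℕ,
      0 ≤ TruncatedTheta.gammaCoeff {2, 3, 7, 13, 17} A B k n) ∧
    (∀ k : ℕ, 1 ≤ k →
      TruncatedTheta.HasNatCoeffs
        (TruncatedTheta.recip
          (TruncatedTheta.qPochInf ((PowerSeries.X : PowerSeries ℤ) ^ 2) (PowerSeries.X ^ 5) *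
            TruncatedTheta.qPochInf ((PowerSeries.X : PowerSeries ℤ) ^ 3) (PowerSeries.X ^ 5)) *
          TruncatedTheta.thetaTail A B k)) := by
  obtain ⟨a, b, hab, rfl, rfl⟩ : ∃ a b : ℕ, TruncatedTheta.IsAdmissible a b ∧
      A = a + b / 2 ∧ B = b / 2 := by
    simp only [Set.mem_insert_iff, Set.mem_singleton_iff, Prod.mk.injEq] at hAB
    rcases hAB with ⟨rfl, rfl⟩ | ⟨rfl, rfl⟩ | ⟨rfl, rfl⟩ | ⟨rfl, rfl⟩
    · exact ⟨1, 3, by simp [TruncatedTheta.IsAdmissible], by norm_num, by norm_num⟩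
    · exact ⟨2, 1, by simp [TruncatedTheta.IsAdmissible], by norm_num, by norm_num⟩
    · exact ⟨1, 5, by simp [TruncatedTheta.IsAdmissible], by norm_num, by norm_num⟩
    · exact ⟨2, 3, by simp [TruncatedTheta.IsAdmissible], by norm_num, by norm_num⟩
  refine ⟨fun k hk n => TruncatedTheta.gammaCoeff_nonneg hab hk n, fun k hk => ?_⟩
  obtain ⟨R, hR, hE⟩ := TruncatedTheta.recip_qPochInf_eq_partSeries_mul
  rw [hE, mul_comm _ R, mul_assoc]
  exact (hR.mul fun n => TruncatedTheta.gammaCoeff_nonneg hab hk n).hasNatCoeffs
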